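/- Let $n\ge 0$ and $[n]=\{1,\dots,n\}$. For $r:2^{[n]}\to\mathbb R$ and $p>0$ let $$\mathrm Z_{p,r}(w_0,w_1,\dots,w_n)=\sum_{S\subseteq[n]}p^{-r(S)}\,w_0^{\,n-|S|}\prod_{i\in S}w_i ,$$ and let $\mathscr L_n$ be the set of all $r:2^{[n]}\to\mathbb R$ such that $\mathrm Z_{p,r}$ is Lorentzian for every real $p$ with $0<p\le 1$. Here a homogeneous real polynomial of degree $d$ is called strictly Lorentzian if all its coefficients (of all monomials of degree $d$) are positive and, for any indices $i_1,\dots,i_{d-2}$, the quadratic form $\partial_{i_1}\cdots\partial_{i_{d-2}}h$ has signature $(+,-,\dots,-)$ (no condition on derivatives if $d<2$); a polynomial is Lorentzian if it is a coefficientwise limit of strictly Lorentzian polynomials of the same degree in the same variables. A function $r:2^{[n]}\to\mathbb R$ is $\mathrm M^\natural$-concave if for all $X,Y\subseteq[n]$ and $i\in X\setminus Y$, either $r(X)+r(Y)\le r(X\setminus i)+r(Y\cup i)$, or there is $j\in Y\setminus X$ with $r(X)+r(Y)\le r((X\setminus i)\cup j)+r((Y\setminus j)\cup i)$. Then the following hold.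 1. Every $r\in\mathscr L_n$ is $\mathrm M^\natural$-concave. 2. In particular, $\mathscr L_n$ is contained in the cone of submodular functions on $2^{[n]}$: every $r\in\mathscr L_n$ satisfies $r(S\cup T)+r(S\cap T)\le r(S)+r(T)$ for all $S,T\subseteq[n]$. 3. (Shioura's theorem) Let $(\mathrm M_1,\dots,\mathrm M_\ell)$ be a flag matroid on $[n]$, that is, a sequence of matroids on $[n]$ such that for $0<k<\ell$ the matroid $\mathrm M_k$ is a quotient of $\mathrm M_{k+1}$, meaning that $\operatorname{rk}_{\mathrm M_k}(S_2)-\operatorname{rk}_{\mathrm M_k}(S_1)\le\operatorname{rk}_{\mathrm M_{k+1}}(S_2)-\operatorname{rk}_{\mathrm M_{k+1}}(S_1)$ for all $S_1\subseteq S_2\subseteq[n]$. Then for all real $c_1,\dots,c_\ell\ge 0$ the function $c_1\operatorname{rk}_{\mathrm M_1}+\dots+c_\ell\operatorname{rk}_{\mathrm M_\ell}$ on $2^{[n]}$ is $\mathrm M^\natural$-concave. -/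

import Mathlib

open Filter Topology

noncomputable section

/-- The quadratic form `x ↦ xᵀ H x` of the Hessian matrix `H` of `g`. For a quadratic polynomial
`g` this is twice the quadratic form `x ↦ g x`, so it has the same signature. -/
def hessianForm {σ : Type*} [Fintype σ] [DecidableEq σ] (g : MvPolynomial σ ℝ) :
    QuadraticForm ℝ (σ → ℝ) :=
  (Matrix.of fun i j : σ =>
    MvPolynomial.constantCoeff (MvPolynomial.pderiv i (MvPolynomial.pderiv j g))).toQuadraticForm'

/-- The signature of the form is `(+,-,…,-)`: one plus and `|σ| - 1` minuses. -/
def HasLorentzianSignature {σ : Type*} [Fintype σ] (Q : QuadraticForm ℝ (σ → ℝ)) : Prop :=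
  sigPos Q = 1 ∧ sigNeg Q + 1 = Fintype.card σ

/-- The iterated partial derivative `∂_{i₁} ⋯ ∂_{iₖ} h` for a list `i₁, …, iₖ` of indices. -/
def iterPDeriv {σ : Type*} (l : List σ) (h : MvPolynomial σ ℝ) : MvPolynomial σ ℝ :=
  l.foldr (fun i g => MvPolynomial.pderiv i g) h

/-- Strictly Lorentzian polynomials of degree `d`: homogeneous, with every monomial of degree `d`
having a positive coefficient, and all `(d-2)`-fold derivatives having signature `(+,-,…,-)`
(no condition on derivatives if `d < 2`). -/
structure IsStrictlyLorentzian {σ : Type*} [Fintype σ] [DecidableEq σ] (d : ℕ)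
    (h : MvPolynomial σ ℝ) : Prop where
  isHomogeneous : h.IsHomogeneous d
  coeff_pos : ∀ m : σ →₀ ℕ, m.degree = d → 0 < h.coeff m
  signature : ∀ l : List σ, l.length + 2 = d →
    HasLorentzianSignature (hessianForm (iterPDeriv l h))

/-- Lorentzian polynomials of degree `d`: coefficientwise limits of strictly Lorentzian polynomials
of degree `d` in the same variables. -/
def IsLorentzian {σ : Type*} [Fintype σ] [DecidableEq σ] (d : ℕ) (h : MvPolynomial σ ℝ) : Prop :=
  ∃ g : ℕ → MvPolynomial σ ℝ, (∀ k, IsStrictlyLorentzian d (g k)) ∧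
    ∀ m : σ →₀ ℕ, Tendsto (fun k => (g k).coeff m) atTop (𝓝 (h.coeff m))

/-- The homogeneous multivariate Tutte polynomial of `r : 2^[n] → ℝ`,
`Z_{p,r}(w₀, …, wₙ) = ∑_S p^{-r(S)} w₀^{n-|S|} ∏_{i ∈ S} wᵢ`. The ground set `[n]` is `Fin n`, and
its element `i` corresponds to the variable with index `i.succ`. -/
def tuttePoly {n : ℕ} (p : ℝ) (r : Finset (Fin n) → ℝ) : MvPolynomial (Fin (n + 1)) ℝ :=
  ∑ S : Finset (Fin n), MvPolynomial.C (p ^ (-(r S))) *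
    (MvPolynomial.X 0 ^ (n - S.card) * ∏ i ∈ S, MvPolynomial.X i.succ)

/-- The set `𝓛ₙ` of all `r : 2^[n] → ℝ` such that `Z_{p,r}` is Lorentzian for all `0 < p ≤ 1`. -/
def lorentzianSetFunctions (n : ℕ) : Set (Finset (Fin n) → ℝ) :=
  {r | ∀ p : ℝ, 0 < p → p ≤ 1 → IsLorentzian n (tuttePoly p r)}

/-- `M♮`-concavity of a set function, by the exchange property. -/
def IsMNaturalConcave {E : Type*} [DecidableEq E] (r : Finset E → ℝ) : Prop :=
  ∀ X Y : Finset E, ∀ i ∈ X \ Y,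
    r X + r Y ≤ r (X.erase i) + r (insert i Y) ∨
    ∃ j ∈ Y \ X, r X + r Y ≤ r (insert j (X.erase i)) + r (insert i (Y.erase j))

/-- The cone of submodular functions on `2^[n]`. -/
def submodularCone (n : ℕ) : ConvexCone ℝ (Finset (Fin n) → ℝ) where
  carrier := {r | ∀ S T : Finset (Fin n), r (S ∪ T) + r (S ∩ T) ≤ r S + r T}
  smul_mem' := by
    intro c hc r hr S T
    have h := mul_le_mul_of_nonneg_left (hr S T) hc.le
    simp only [Pi.smul_apply, smul_eq_mul]
    linarith
  add_mem' := by
    intro r hr s hs S T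
    have h₁ := hr S T
    have h₂ := hs S T
    simp only [Pi.add_apply]
    linarith

/-- The rank function of a matroid on (a subset of) a finite set. -/
def matroidRk {E : Type*} (M : Matroid E) (S : Finset E) : ℕ :=
  (M.eRk (S : Set E)).toNat

/-- `N` is a quotient of `M`, where both are matroids on the ground set `E`:
`rk_N S₂ - rk_N S₁ ≤ rk_M S₂ - rk_M S₁` whenever `S₁ ⊆ S₂`. -/
def IsMatroidQuotient {E : Type*} (N M : Matroid E) : Prop :=
  ∀ S₁ S₂ : Finset E, S₁ ⊆ S₂ →
    matroidRk N S₂ + matroidRk M S₁ ≤ matroidRk M S₂ + matroidRk N S₁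

/-- `(M₁, …, M_ℓ)` is a flag matroid on the ground set `E`: the matroid `M_k` is a quotient of
`M_{k+1}` for all `0 < k < ℓ`. -/
structure IsFlagMatroid {E : Type*} {ℓ : ℕ} (M : Fin ℓ → Matroid E) : Prop where
  ground_eq : ∀ k, (M k).E = Set.univ
  quotient : ∀ k k' : Fin ℓ, k.val + 1 = k'.val → IsMatroidQuotient (M k) (M k')

end

/-! The link between the Lorentzian property and concavity is a limit `p → 0`. Each `(d-2)`-fold
derivative of a strictly Lorentzian polynomial is a quadratic form with one positive sign, so
reverse Cauchy–Schwarz applies. It yields `H a b * H c e ≤ 2 * (H a c * H b e + H a e * H b c)` for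
the Hessian. Passing to coefficients and to limits costs only a constant `K` independent of the
polynomial. For `tuttePoly p r` the coefficients are powers of `p`, so letting `p → 0` erases `K`
and leaves a three-term inequality for the exponents.

To treat all monomials alike, `n` dummy elements are adjoined, each standing for `w₀`; then `r`
becomes a function on the `n`-subsets of a `2n`-element set. For such everywhere finite functions
three-term exchange implies full exchange, which restricts to `M♮`-concavity of `r`; submodularity
follows from that.

For flag matroids the local inequalities are checked directly. A violation for the weighted sum
would need two members of the flag that violate different alternatives, and the quotient relation
between them excludes this. -/

/-! ### Exchange properties and `M♮`-concavity -/

/-- The three-term exchange inequalities for a function on the `d`-subsets of `α`. -/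
def ThreeTermExchange {α : Type*} [DecidableEq α] (d : ℕ) (ω : Finset α → ℝ) : Prop :=
  ∀ (S : Finset α) (a b c e : α), S.card + 2 = d → a ∉ S → b ∉ S → c ∉ S → e ∉ S →
    a ≠ b → a ≠ c → a ≠ e → b ≠ c → b ≠ e → c ≠ e →
    ω (insert a (insert b S)) + ω (insert c (insert e S)) ≤
      max (ω (insert a (insert c S)) + ω (insert b (insert e S)))
        (ω (insert a (insert e S)) + ω (insert b (insert c S)))

/-- Three-term exchange implies the full exchange property of valuated matroids, for functions
with finite values on all `d`-subsets. -/
theorem ThreeTermExchange.exists_exchange {α : Type*} [DecidableEq α] {d : ℕ} {ω : Finset α → ℝ}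
    (h : ThreeTermExchange d ω) {X Y : Finset α} (hX : X.card = d) (hY : Y.card = d) {i : α}
    (hi : i ∈ X \ Y) :
    ∃ j ∈ Y \ X, ω X + ω Y ≤ ω (insert j (X.erase i)) + ω (insert i (Y.erase j)) := by
  induction hk : (Y \ X).card generalizing Y with
  | zero =>
    have h1 := Finset.card_sdiff_add_card_inter X Y
    have h2 := Finset.card_sdiff_add_card_inter Y X
    have h3 := Finset.card_pos.2 ⟨i, hi⟩
    rw [Finset.inter_comm] at h2
    omega
  | succ k ih =>
    by_contra! hfail
    have hcard : (X \ Y).card = k + 1 := by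
      have h1 := Finset.card_sdiff_add_card_inter X Y
      have h2 := Finset.card_sdiff_add_card_inter Y X
      rw [Finset.inter_comm] at h2
      omega
    have hne : (Y \ X).Nonempty := Finset.card_pos.1 (by omega)
    simp only [Finset.mem_sdiff] at hi
    -- If `X` and `Y` differ by a single swap, the exchange interchanges them and the inequality is
    -- an equality.
    rcases Nat.eq_zero_or_pos k with rfl | hkpos
    · obtain ⟨j, hj⟩ := Finset.card_eq_one.1 hk
      obtain ⟨i', hi'⟩ := Finset.card_eq_one.1 hcard
      simp only [Finset.ext_iff, Finset.mem_sdiff, Finset.mem_singleton] at hj hi'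
      have e1 : insert j (X.erase i) = Y := by
        ext x
        have := hj x; have := hi' x; have := hi' i; have := hj j
        grind
      have e2 : insert i (Y.erase j) = X := by
        ext x
        have := hj x; have := hi' x; have := hi' i; have := hj j
        grind
      have := hfail j (by simpa using (hj j).2 rfl)
      rw [e1, e2] at this
      linarith
    · obtain ⟨u, hu, hui⟩ := Finset.exists_mem_ne (by omega : 1 < (X \ Y).card) i
      rw [Finset.mem_sdiff] at hu
      -- Induction gives `v` for the pair `X`, `Y - v₀ + u`. Adding the three-term inequality on `Y
      -- - v₀ - v` yields the exchange with `j = v` directly, or with `j = v₀` by maximality of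
      -- `v₀`.
      obtain ⟨v₀, hv₀, hmax⟩ := Finset.exists_max_image (Y \ X)
        (fun v => ω (insert u (Y.erase v)) + ω (insert v (X.erase i))) hne
      have hv₀' := Finset.mem_sdiff.1 hv₀
      have hsd : insert u (Y.erase v₀) \ X = (Y \ X).erase v₀ := by
        ext x; grind
      obtain ⟨v, hv, hvle⟩ := ih (Y := insert u (Y.erase v₀))
        (by rw [Finset.card_insert_of_notMem (by grind), Finset.card_erase_of_mem hv₀'.1]
            have := Finset.card_pos.2 ⟨v₀, hv₀'.1⟩
            omega)
        (by grind) (by rw [hsd, Finset.card_erase_of_mem hv₀]; omega)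
      rw [hsd, Finset.mem_erase] at hv
      have hv' := Finset.mem_sdiff.1 hv.2
      have hT : ((Y.erase v₀).erase v).card + 2 = d := by
        have h1 : v ∈ Y.erase v₀ := by grind
        have h2 := Finset.card_erase_add_one h1
        have h3 := Finset.card_erase_add_one hv₀'.1
        omega
      have key := h ((Y.erase v₀).erase v) v₀ v u i hT (by grind) (by grind) (by grind) (by grind)
        (by grind) (by grind) (by grind) (by grind) (by grind) hui
      have f1 := hfail v hv.2
      have f2 := hfail v₀ hv₀
      have f3 := hmax v hv.2
      have e1 : insert v₀ (insert v ((Y.erase v₀).erase v)) = Y := by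
        rw [Finset.insert_erase (by grind), Finset.insert_erase hv₀'.1]
      have e4 : insert v (insert i ((Y.erase v₀).erase v)) = insert i (Y.erase v₀) := by
        rw [Finset.insert_comm, Finset.insert_erase (by grind)]
      have e6 : insert v (insert u ((Y.erase v₀).erase v)) = insert u (Y.erase v₀) := by
        rw [Finset.insert_comm, Finset.insert_erase (by grind)]
      have e2 : insert u (insert i ((Y.erase v₀).erase v)) =
          insert i ((insert u (Y.erase v₀)).erase v) := by
        rw [Finset.erase_insert_of_ne (by grind), Finset.insert_comm]
      have e3 : insert v₀ (insert u ((Y.erase v₀).erase v)) = insert u (Y.erase v) := by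
        rw [Finset.insert_comm, Finset.erase_right_comm, Finset.insert_erase (by grind)]
      have e5 : insert v₀ (insert i ((Y.erase v₀).erase v)) = insert i (Y.erase v) := by
        rw [Finset.insert_comm, Finset.erase_right_comm, Finset.insert_erase (by grind)]
      rw [e1, e2, e3, e4, e5, e6] at key
      rcases le_max_iff.1 key with key | key <;> linarith

/-- A set function is `M♮`-concave if its homogenization satisfies the three-term exchange. -/
theorem isMNaturalConcave_of_threeTermExchange {E : Type*} [Fintype E] [DecidableEq E]
    {r : Finset E → ℝ}
    (h : ThreeTermExchange (Fintype.card E) fun B : Finset (E ⊕ E) => r B.toLeft) :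
    IsMNaturalConcave r := by
  intro X Y i hi
  have lift : ∀ Z : Finset E, ∃ D : Finset E, (Z.disjSum D).card = Fintype.card E := fun Z => by
    obtain ⟨D, -, hD⟩ := Finset.exists_subset_card_eq
      (show Fintype.card E - Z.card ≤ (Finset.univ : Finset E).card by simp)
    exact ⟨D, by rw [Finset.card_disjSum, hD]; have := Z.card_le_univ; omega⟩
  obtain ⟨D, hD⟩ := lift X
  obtain ⟨D', hD'⟩ := lift Y
  have hi' : (Sum.inl i : E ⊕ E) ∈ X.disjSum D \ Y.disjSum D' := by simpa using hi
  obtain ⟨j, hj, hle⟩ := h.exists_exchange hD hD' hi'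
  have el : ∀ (Z D : Finset E) (x : E), ((Z.disjSum D).erase (Sum.inl x)).toLeft = Z.erase x := by
    intro Z D x; ext y; simp
  have er : ∀ (Z D : Finset E) (x : E), ((Z.disjSum D).erase (Sum.inr x)).toLeft = Z := by
    intro Z D x; ext y; simp
  -- A genuine exchange partner gives the second alternative of `M♮`-concavity, a dummy one the
  -- first.
  rcases j with j | j
  · right
    refine ⟨j, by simpa using hj, ?_⟩
    simpa [el] using hle
  · left
    simpa [el, er] using hle

/-- Local characterization of `M♮`-concavity: local submodularity together with the exchange
inequality for three elements. -/
theorem isMNaturalConcave_of_local {E : Type*} [Fintype E] [DecidableEq E] {r : Finset E → ℝ}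
    (h₂ : ∀ (S : Finset E) (a b : E), a ∉ S → b ∉ S → a ≠ b →
      r (insert a (insert b S)) + r S ≤ r (insert a S) + r (insert b S))
    (h₃ : ∀ (S : Finset E) (a b c : E), a ∉ S → b ∉ S → c ∉ S → a ≠ b → a ≠ c → b ≠ c →
      r (insert a (insert b S)) + r (insert c S) ≤
        max (r (insert a (insert c S)) + r (insert b S))
          (r (insert b (insert c S)) + r (insert a S))) :
    IsMNaturalConcave r := by
  have h₄ : ∀ (S : Finset E) (a b c e : E), a ∉ S → b ∉ S → c ∉ S → e ∉ S →
      a ≠ b → a ≠ c → a ≠ e → b ≠ c → b ≠ e → c ≠ e →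
      r (insert a (insert b S)) + r (insert c (insert e S)) ≤
        max (r (insert a (insert c S)) + r (insert b (insert e S)))
          (r (insert a (insert e S)) + r (insert b (insert c S))) := by
    -- With `w x y = r (S + x + y) - r (S + x) - r (S + y)`, `h₃` reads `w a b ≤ max (w a c) (w b
    -- c)`, an ultrametric inequality. The claim is the four-point condition for `w`, which follows
    -- from it on the four triples.
    intro S a b c e ha hb hc he hab hac hae hbc hbe hce
    have c1 := Finset.insert_comm b a S
    have c2 := Finset.insert_comm c a S
    have c3 := Finset.insert_comm e a S
    have c4 := Finset.insert_comm c b S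
    have c5 := Finset.insert_comm e b S
    have c6 := Finset.insert_comm e c S
    have t1 := h₃ S a b c ha hb hc hab hac hbc
    have t2 := h₃ S a c b ha hc hb hac hab hbc.symm
    have t3 := h₃ S b c a hb hc ha hbc hab.symm hac.symm
    have t4 := h₃ S a b e ha hb he hab hae hbe
    have t5 := h₃ S a e b ha he hb hae hab hbe.symm
    have t6 := h₃ S b e a hb he ha hbe hab.symm hae.symm
    have t7 := h₃ S a c e ha hc he hac hae hce
    have t8 := h₃ S a e c ha he hc hae hac hce.symm
    have t9 := h₃ S c e a hc he ha hce hac.symm hae.symm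
    have s1 := h₃ S b c e hb hc he hbc hbe hce
    have s2 := h₃ S b e c hb he hc hbe hbc hce.symm
    have s3 := h₃ S c e b hc he hb hce hbc.symm hbe.symm
    rw [c1, c2, c3, c4, c5, c6] at *
    clear h₂ h₃ c1 c2 c3 c4 c5 c6
    grind
  refine isMNaturalConcave_of_threeTermExchange ?_
  -- No dummy among the four elements gives `h₄`, one gives `h₃`. Two give `h₂` or a trivial case,
  -- and with three or more both sides agree.
  rintro S (a | a) (b | b) (c | c) (e | e) - ha hb hc he hab hac hae hbc hbe hce <;>
    simp only [Finset.toLeft_insert_inl, Finset.toLeft_insert_inr] <;>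
    simp only [← Finset.mem_toLeft, ne_eq, Sum.inl.injEq] at ha hb hc he hab hac hae hbc hbe hce
  · exact h₄ S.toLeft a b c e ha hb hc he hab hac hae hbc hbe hce
  · have := h₃ S.toLeft a b c ha hb hc hab hac hbc
    rcases le_max_iff.1 this with h | h
    · exact le_max_of_le_left h
    · exact le_max_of_le_right (by linarith)
  · have := h₃ S.toLeft a b e ha hb he hab hae hbe
    rcases le_max_iff.1 this with h | h
    · exact le_max_of_le_right (by linarith)
    · exact le_max_of_le_left (by linarith)
  · exact le_max_of_le_left (h₂ S.toLeft a b ha hb hab)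
  · have := h₃ S.toLeft c e a hc he ha hce (Ne.symm hac) (Ne.symm hae)
    rw [Finset.insert_comm c a, Finset.insert_comm e a] at this
    rcases le_max_iff.1 this with h | h
    · exact le_max_of_le_left (by linarith)
    · exact le_max_of_le_right (by linarith)
  · exact le_max_right _ _
  · exact le_max_left _ _
  · exact le_max_left _ _
  · have := h₃ S.toLeft c e b hc he hb hce (Ne.symm hbc) (Ne.symm hbe)
    rw [Finset.insert_comm c b, Finset.insert_comm e b] at this
    rcases le_max_iff.1 this with h | h
    · exact le_max_of_le_right (by linarith)
    · exact le_max_of_le_left (by linarith)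
  · exact le_max_of_le_left (add_comm _ _).le
  · exact le_max_of_le_right (add_comm _ _).le
  · exact le_max_of_le_left (add_comm _ _).le
  · have := h₂ S.toLeft c e hc he hce
    exact le_max_of_le_left (by linarith)
  · exact le_max_of_le_left (add_comm _ _).le
  · exact le_max_of_le_left le_rfl
  · exact le_max_of_le_left le_rfl

/-- `M♮`-concave set functions are submodular. -/
theorem IsMNaturalConcave.submodular {E : Type*} [DecidableEq E] {r : Finset E → ℝ}
    (h : IsMNaturalConcave r) (S T : Finset E) : r (S ∪ T) + r (S ∩ T) ≤ r S + r T := by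
  have key : ∀ U : Finset E, Disjoint U T →
      ∀ I : Finset E, I ⊆ T → r (T ∪ U) + r I ≤ r (I ∪ U) + r T := by
    intro U
    induction U using Finset.induction_on with
    | empty => intro _ I _; simp [add_comm]
    | insert i U hi ih =>
      intro hU I hI
      rw [Finset.disjoint_insert_left] at hU
      have h1 := ih hU.2 I hI
      have hiI : i ∉ I := fun h => hU.1 (hI h)
      -- The second set minus the first is empty, so only the alternative without a partner `j` can
      -- hold.
      have h2 := h (T ∪ insert i U) (I ∪ U) i (by simp [hi, hiI])
      have e1 : (T ∪ insert i U).erase i = T ∪ U := by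
        rw [Finset.union_insert, Finset.erase_insert (by simp [hi, hU.1])]
      have e2 : (I ∪ U) \ (T ∪ insert i U) = ∅ := by
        rw [Finset.sdiff_eq_empty_iff_subset]
        exact Finset.union_subset_union hI (Finset.subset_insert _ _)
      rw [e1, e2, ← Finset.union_insert] at h2
      simp only [Finset.notMem_empty, false_and, exists_false, or_false] at h2
      linarith
  have := key (S \ T) Finset.sdiff_disjoint (S ∩ T) Finset.inter_subset_right
  rw [Finset.union_sdiff_self_eq_union, Finset.union_comm T S, Finset.union_comm (S ∩ T),
    Finset.sdiff_union_inter] at this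
  exact this

/-! ### Quadratic forms with one positive sign -/

/-- Reverse Cauchy–Schwarz inequality for a quadratic form with at most one positive sign. -/
theorem QuadraticForm.mul_le_polar_sq_of_sigPos_le_one {V : Type*} [AddCommGroup V] [Module ℝ V]
    [FiniteDimensional ℝ V] {Q : QuadraticForm ℝ V} (hQ : sigPos Q ≤ 1) {u v : V} (hu : 0 < Q u) :
    4 * (Q u * Q v) ≤ QuadraticMap.polar Q u v ^ 2 := by
  -- Otherwise `Q` would be positive definite on the plane spanned by `u` and `v`, forcing `sigPos Q
  -- ≥ 2`.
  by_contra! hlt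
  have hexp : ∀ a b : ℝ, Q (a • u + b • v) =
      a ^ 2 * Q u + b ^ 2 * Q v + a * b * QuadraticMap.polar Q u v := by
    intro a b
    rw [QuadraticMap.map_add Q, QuadraticMap.map_smul, QuadraticMap.map_smul,
      QuadraticMap.polar_smul_left, QuadraticMap.polar_smul_right]
    simp only [smul_eq_mul]
    ring
  have hpos : ∀ a b : ℝ, (a ≠ 0 ∨ b ≠ 0) → 0 < Q (a • u + b • v) := by
    intro a b hab
    rw [hexp]
    set q := QuadraticMap.polar Q u v
    have hsq : 4 * Q u * (a ^ 2 * Q u + b ^ 2 * Q v + a * b * q) =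
      (2 * a * Q u + b * q) ^ 2 + b ^ 2 * (4 * (Q u * Q v) - q ^ 2) := by ring
    have : 0 < (2 * a * Q u + b * q) ^ 2 + b ^ 2 * (4 * (Q u * Q v) - q ^ 2) := by
      by_cases hb : b = 0
      · subst hb
        have ha : a ≠ 0 := by simpa using hab
        have : 2 * a * Q u ≠ 0 := by positivity
        simp only [zero_mul, add_zero]
        positivity
      · have : 0 < 4 * (Q u * Q v) - q ^ 2 := by linarith
        positivity
    rw [← hsq] at this
    exact (pos_iff_pos_of_mul_pos this).1 (by positivity)
  have hli : LinearIndependent ℝ ![u, v] := by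
    rw [LinearIndependent.pair_iff]
    intro a b h0
    by_contra hab
    have := hpos a b (by tauto)
    rw [h0, QuadraticMap.map_zero] at this
    exact lt_irrefl _ this
  have hpd : (Q.restrict (Submodule.span ℝ (Set.range ![u, v]))).PosDef := by
    rintro ⟨x, hx⟩ hx0
    rw [Matrix.range_cons, Matrix.range_cons, Matrix.range_empty, Set.union_empty,
      Set.singleton_union, Submodule.mem_span_pair] at hx
    obtain ⟨a, b, rfl⟩ := hx
    rw [QuadraticMap.restrict_apply]
    refine hpos a b ?_
    by_contra! h
    exact hx0 (by simp [h.1, h.2])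
  have := le_sigPos_of_posDef Q hpd
  rw [finrank_span_eq_card hli, Fintype.card_fin] at this
  omega

theorem sum_sum_single_add_single {σ : Type*} [Fintype σ] [DecidableEq σ] (H : Matrix σ σ ℝ)
    (a b c e : σ) (α β γ δ : ℝ) :
    ∑ i, ∑ j, (Pi.single a α + Pi.single b β : σ → ℝ) i * H i j *
        (Pi.single c γ + Pi.single e δ : σ → ℝ) j =
      α * γ * H a c + α * δ * H a e + β * γ * H b c + β * δ * H b e := by
  simp only [Pi.add_apply, add_mul, mul_add, Finset.sum_add_distrib, Pi.single_apply, ite_mul,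
    mul_ite, zero_mul, mul_zero, Finset.sum_ite_eq', Finset.mem_univ, if_true]
  ring

/-- A symmetric matrix with positive entries and a single positive sign satisfies an approximate
three-term exchange inequality. -/
theorem Matrix.mul_le_of_sigPos_le_one {σ : Type*} [Fintype σ] [DecidableEq σ] {H : Matrix σ σ ℝ}
    (hpos : ∀ i j, 0 < H i j) (hsymm : ∀ i j, H i j = H j i)
    (hsig : sigPos H.toQuadraticForm' ≤ 1) (a b c e : σ) :
    H a b * H c e ≤ 2 * (H a c * H b e + H a e * H b c) := by
  have hsq : ∀ i j, ∃ s : ℝ, 0 < s ∧ H i j = s ^ 2 := fun i j =>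
    ⟨√(H i j), Real.sqrt_pos.2 (hpos i j), (Real.sq_sqrt (hpos i j).le).symm⟩
  obtain ⟨s, hs, hs'⟩ := hsq a c
  obtain ⟨t, ht, ht'⟩ := hsq b e
  obtain ⟨x, hx, hx'⟩ := hsq a e
  obtain ⟨y, hy, hy'⟩ := hsq b c
  -- These weights balance the four cross terms: `uᵀHv = 2stxy(st + xy)`. Dropping the diagonal
  -- terms leaves `Q u ≥ 2stxy * H a b` and `Q v ≥ 2stxy * H c e`. The indices may coincide, as they
  -- do for dummies.
  set u : σ → ℝ := Pi.single a (t * y) + Pi.single b (s * x) with hu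
  set v : σ → ℝ := Pi.single c (x * t) + Pi.single e (s * y) with hv
  have hQ : ∀ z : σ → ℝ, H.toQuadraticForm' z = ∑ i, ∑ j, z i * H i j * z j := by
    intro z
    simp [Matrix.toQuadraticForm', Matrix.toLinearMap₂'_apply, mul_comm, mul_left_comm]
  have hP : QuadraticMap.polar H.toQuadraticForm' u v = 2 * ∑ i, ∑ j, u i * H i j * v j := by
    have hc : ∑ i, ∑ j, v i * H i j * u j = ∑ i, ∑ j, u i * H i j * v j := by
      rw [Finset.sum_comm]
      refine Finset.sum_congr rfl fun i _ => Finset.sum_congr rfl fun j _ => ?_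
      rw [hsymm j i]; ring
    rw [QuadraticMap.polar, hQ, hQ, hQ]
    simp only [Pi.add_apply, add_mul, mul_add, Finset.sum_add_distrib, hc]
    ring
  have hQu : H.toQuadraticForm' u = _ := (hQ u).trans (sum_sum_single_add_single _ _ _ _ _ _ _ _ _)
  have hQv : H.toQuadraticForm' v = _ := (hQ v).trans (sum_sum_single_add_single _ _ _ _ _ _ _ _ _)
  rw [hu, hv, sum_sum_single_add_single, ← hu, ← hv] at hP
  have haa := hpos a a
  have hbb := hpos b b
  have hcc := hpos c c
  have hee := hpos e e
  have hab := hpos a b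
  have hce := hpos c e
  rw [hsymm b a] at hQu
  rw [hsymm e c] at hQv
  have h1 : 2 * (t * y * (s * x)) * H a b ≤ H.toQuadraticForm' u := by
    rw [hQu]
    have : 0 ≤ t * y * (t * y) * H a a + s * x * (s * x) * H b b := by positivity
    linarith
  have h2 : 2 * (x * t * (s * y)) * H c e ≤ H.toQuadraticForm' v := by
    rw [hQv]
    have : 0 ≤ x * t * (x * t) * H c c + s * y * (s * y) * H e e := by positivity
    linarith
  have hu0 : 0 < H.toQuadraticForm' u := lt_of_lt_of_le (by positivity) h1
  have hmain := QuadraticForm.mul_le_polar_sq_of_sigPos_le_one hsig (v := v) hu0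
  have h3 := mul_le_mul h1 h2 (by positivity) hu0.le
  rw [hP, hs', ht', hx', hy'] at hmain
  have h4 : 16 * (s * t * x * y) ^ 2 * (H a b * H c e) ≤
      16 * (s * t * x * y) ^ 2 * (s * t + x * y) ^ 2 := by
    nlinarith [h3, hmain]
  have h5 := le_of_mul_le_mul_left h4 (by positivity)
  rw [hs', ht', hx', hy']
  nlinarith [sq_nonneg (s * t - x * y)]

/-! ### Coefficients of Lorentzian polynomials -/

/-- The factor `C` is a product of exponents, the same for every `g`; this is what makes the later
bound uniform. -/
theorem exists_coeff_iterPDeriv {σ : Type*} [DecidableEq σ] (l : List σ) (m : σ →₀ ℕ) :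
    ∃ C : ℝ, 0 < C ∧ ∀ g : MvPolynomial σ ℝ,
      (iterPDeriv l g).coeff m = C * g.coeff (m + (l.map fun i => Finsupp.single i 1).sum) := by
  induction l generalizing m with
  | nil => exact ⟨1, one_pos, fun g => by simp [iterPDeriv]⟩
  | cons i l ih =>
    obtain ⟨C, hC, h⟩ := ih (m + Finsupp.single i 1)
    refine ⟨C * (m i + 1), by positivity, fun g => ?_⟩
    have : iterPDeriv (i :: l) g = MvPolynomial.pderiv i (iterPDeriv l g) := rfl
    rw [this, MvPolynomial.coeff_pderiv, h, List.map_cons, List.sum_cons, add_assoc]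
    ring

theorem degree_list_sum_single {σ : Type*} (l : List σ) :
    ((l.map fun i => Finsupp.single i 1).sum : σ →₀ ℕ).degree = l.length := by
  induction l with
  | nil => simp
  | cons i l ih => simp [ih, add_comm]

/-- Coefficients of strictly Lorentzian polynomials satisfy an approximate three-term exchange
inequality. -/
theorem IsStrictlyLorentzian.mul_le {σ : Type*} [Fintype σ] [DecidableEq σ] {d : ℕ}
    {g : MvPolynomial σ ℝ} (hg : IsStrictlyLorentzian d g) {l : List σ} (hl : l.length + 2 = d)
    (a b c e : σ) :
    (iterPDeriv (a :: b :: l) g).coeff 0 * (iterPDeriv (c :: e :: l) g).coeff 0 ≤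
      2 * ((iterPDeriv (a :: c :: l) g).coeff 0 * (iterPDeriv (b :: e :: l) g).coeff 0 +
        (iterPDeriv (a :: e :: l) g).coeff 0 * (iterPDeriv (b :: c :: l) g).coeff 0) := by
  refine Matrix.mul_le_of_sigPos_le_one (H := Matrix.of fun i j : σ =>
    MvPolynomial.constantCoeff
      (MvPolynomial.pderiv i (MvPolynomial.pderiv j (iterPDeriv l g)))) ?_ ?_
    (hg.signature l hl).1.le a b c e
  · intro i j
    obtain ⟨C, hC, h⟩ := exists_coeff_iterPDeriv (i :: j :: l) 0
    change 0 < (iterPDeriv (i :: j :: l) g).coeff 0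
    rw [h]
    refine mul_pos hC (hg.coeff_pos _ ?_)
    rw [zero_add, degree_list_sum_single]
    simpa using hl
  · intro i j
    simp only [Matrix.of_apply]
    congr 1
    ext m
    simp only [MvPolynomial.coeff_pderiv, Finsupp.add_apply]
    rw [add_right_comm]
    by_cases hij : i = j
    · subst hij; rfl
    · simp [hij, Ne.symm hij]
      ring

/-- Coefficients of Lorentzian polynomials satisfy an approximate three-term exchange inequality,
with a constant that does not depend on the polynomial. -/
theorem IsLorentzian.exists_forall_coeff_mul_le {σ : Type*} [Fintype σ] [DecidableEq σ]
    (l : List σ) (a b c e : σ) :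
    ∃ K : ℝ, 0 < K ∧ ∀ h : MvPolynomial σ ℝ, IsLorentzian (l.length + 2) h →
      ∀ m : σ →₀ ℕ, m = (l.map fun i => Finsupp.single i 1).sum →
      h.coeff (Finsupp.single a 1 + (Finsupp.single b 1 + m)) *
          h.coeff (Finsupp.single c 1 + (Finsupp.single e 1 + m)) ≤
        K * (h.coeff (Finsupp.single a 1 + (Finsupp.single c 1 + m)) *
            h.coeff (Finsupp.single b 1 + (Finsupp.single e 1 + m)) +
          h.coeff (Finsupp.single a 1 + (Finsupp.single e 1 + m)) *
            h.coeff (Finsupp.single b 1 + (Finsupp.single c 1 + m))) := by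
  choose C hC hCg using fun i j : σ => exists_coeff_iterPDeriv (i :: j :: l) 0
  have hC' : ∀ i j, 0 < C i j := hC
  -- Divide by the factor on the left and bound each factor on the right by the sum of both.
  refine ⟨(C a b * C c e)⁻¹ * (2 * (C a c * C b e + C a e * C b c)), ?_, ?_⟩
  · have := hC' a b; have := hC' c e; have := hC' a c; have := hC' b e; have := hC' a e
    have := hC' b c
    positivity
  rintro h ⟨g, hg, hlim⟩ m rfl
  set f : MvPolynomial σ ℝ → σ → σ → ℝ := fun p i j => p.coeff (Finsupp.single i 1 +
    (Finsupp.single j 1 + (l.map fun i => Finsupp.single i 1).sum)) with hf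
  have hstrict : ∀ k, C a b * f (g k) a b * (C c e * f (g k) c e) ≤
      2 * (C a c * f (g k) a c * (C b e * f (g k) b e) +
        C a e * f (g k) a e * (C b c * f (g k) b c)) := by
    intro k
    have := (hg k).mul_le rfl a b c e
    simpa only [hCg, List.map_cons, List.sum_cons, zero_add] using this
  have hfl : ∀ i j, Tendsto (fun k => f (g k) i j) atTop (𝓝 (f h i j)) := fun i j => hlim _
  have hle := le_of_tendsto_of_tendsto'
    (((hfl a b).const_mul (C a b)).mul ((hfl c e).const_mul (C c e)))
    (((((hfl a c).const_mul (C a c)).mul ((hfl b e).const_mul (C b e))).add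
      (((hfl a e).const_mul (C a e)).mul ((hfl b c).const_mul (C b c)))).const_mul 2) hstrict
  have hnn : ∀ i j, 0 ≤ f h i j := fun i j => ge_of_tendsto' (hfl i j) fun k =>
    ((hg k).coeff_pos _ (by simp [degree_list_sum_single]; omega)).le
  change f h a b * f h c e ≤ _ * (f h a c * f h b e + f h a e * f h b c)
  rw [mul_assoc, ← div_eq_inv_mul, le_div_iff₀ (mul_pos (hC' a b) (hC' c e))]
  have p1 := hC' a b; have p2 := hC' c e; have p3 := hC' a c; have p4 := hC' b e
  have p5 := hC' a e; have p6 := hC' b c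
  have n1 : 0 ≤ C a c * C b e * (f h a e * f h b c) :=
    mul_nonneg (mul_pos p3 p4).le (mul_nonneg (hnn _ _) (hnn _ _))
  have n2 : 0 ≤ C a e * C b c * (f h a c * f h b e) :=
    mul_nonneg (mul_pos p5 p6).le (mul_nonneg (hnn _ _) (hnn _ _))
  nlinarith [hle, n1, n2]

/-! ### The limit `p → 0` for the Tutte polynomial -/

/-- Comparison of exponents from a comparison of powers as the base tends to zero. -/
theorem le_max_of_forall_rpow_le {x y z K : ℝ}
    (h : ∀ p : ℝ, 0 < p → p ≤ 1 → p ^ (-x) ≤ K * (p ^ (-y) + p ^ (-z))) : x ≤ max y z := by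
  by_contra! hlt
  obtain ⟨hy, hz⟩ := max_lt_iff.1 hlt
  have hlim : ∀ w : ℝ, 0 < w → Tendsto (fun p : ℝ => p ^ w) (𝓝[>] 0) (𝓝 0) := by
    intro w hw
    have := (Real.continuousAt_rpow_const 0 w (Or.inr hw.le)).tendsto
    rw [Real.zero_rpow hw.ne'] at this
    exact this.mono_left nhdsWithin_le_nhds
  have hl : Tendsto (fun p : ℝ => K * (p ^ (x - y) + p ^ (x - z))) (𝓝[>] 0) (𝓝 (K * (0 + 0))) :=
    ((hlim _ (by linarith)).add (hlim _ (by linarith))).const_mul K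
  have hev : ∀ᶠ p : ℝ in 𝓝[>] 0, 1 ≤ K * (p ^ (x - y) + p ^ (x - z)) := by
    filter_upwards [Ioc_mem_nhdsGT (zero_lt_one (α := ℝ))] with p hp
    -- After multiplication by `p ^ x` the right side has only positive exponents and tends to `0`,
    -- while the left side is `1`.
    have h1 := mul_le_mul_of_nonneg_left (h p hp.1 hp.2) (Real.rpow_nonneg hp.1.le x)
    rw [← Real.rpow_add hp.1, add_neg_cancel, Real.rpow_zero, mul_left_comm, mul_add,
      ← Real.rpow_add hp.1, ← Real.rpow_add hp.1] at h1
    simpa only [sub_eq_add_neg] using h1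
  have := ge_of_tendsto hl hev
  norm_num at this

/-- The exponent of the monomial of `tuttePoly p r` indexed by `S`. -/
noncomputable def tutteExponent {n : ℕ} (S : Finset (Fin n)) : Fin (n + 1) →₀ ℕ :=
  Finsupp.single 0 (n - S.card) + ∑ i ∈ S, Finsupp.single i.succ 1

theorem tutteExponent_injective (n : ℕ) :
    Function.Injective (tutteExponent : Finset (Fin n) → Fin (n + 1) →₀ ℕ) := by
  have key : ∀ (S : Finset (Fin n)) (i : Fin n), i ∈ S ↔ tutteExponent S i.succ ≠ 0 := by
    intro S i
    simp [tutteExponent, Finsupp.single_apply, Fin.succ_inj]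
  intro S T hST
  ext i
  rw [key, key, hST]

theorem coeff_tuttePoly {n : ℕ} (p : ℝ) (r : Finset (Fin n) → ℝ) (S : Finset (Fin n)) :
    (tuttePoly p r).coeff (tutteExponent S) = p ^ (-(r S)) := by
  have hmon : tuttePoly p r = ∑ T : Finset (Fin n),
      MvPolynomial.monomial (tutteExponent T) (p ^ (-(r T))) := by
    refine Finset.sum_congr rfl fun T _ => ?_
    have h1 : (MvPolynomial.monomial (tutteExponent T)) (1 : ℝ) =
        MvPolynomial.X 0 ^ (n - T.card) * ∏ i ∈ T, MvPolynomial.X i.succ := by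
      rw [tutteExponent, ← one_mul (1 : ℝ), ← MvPolynomial.monomial_mul,
        MvPolynomial.X_pow_eq_monomial, MvPolynomial.monomial_sum_one]
      rfl
    rw [← h1, MvPolynomial.C_mul_monomial, mul_one]
  rw [hmon, MvPolynomial.coeff_sum]
  simp [MvPolynomial.coeff_monomial, (tutteExponent_injective n).eq_iff]

/-- The variable of `tuttePoly` attached to an element of the ground set, doubled by adding
`n` dummy elements. -/
noncomputable def tutteVariable {n : ℕ} : Fin n ⊕ Fin n → Fin (n + 1) :=
  Sum.elim Fin.succ fun _ => 0

/-- An `n`-set `B` contains exactly `n - |B.toLeft|` dummies, which is the exponent of `w₀`. -/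
theorem sum_single_tutteVariable {n : ℕ} (B : Finset (Fin n ⊕ Fin n)) (hB : B.card = n) :
    ∑ b ∈ B, Finsupp.single (tutteVariable b) 1 = tutteExponent B.toLeft := by
  conv_lhs => rw [← Finset.toLeft_disjSum_toRight (u := B), Finset.sum_disjSum]
  have := Finset.card_toLeft_add_card_toRight (u := B)
  have hc : n - B.toLeft.card = B.toRight.card := by omega
  rw [tutteExponent, hc]
  simp [tutteVariable, add_comm]

/-- The constant `K` is chosen before `p`, so the coefficient inequality can be compared as `p → 0`.
-/
theorem threeTermExchange_of_mem_lorentzianSetFunctions {n : ℕ} {r : Finset (Fin n) → ℝ}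
    (hr : r ∈ lorentzianSetFunctions n) :
    ThreeTermExchange (Fintype.card (Fin n)) fun B : Finset (Fin n ⊕ Fin n) => r B.toLeft := by
  rw [Fintype.card_fin]
  intro S a b c e hS ha hb hc he hab hac hae hbc hbe hce
  set l := S.toList.map tutteVariable with hl
  have hlen : l.length + 2 = n := by simpa [hl] using hS
  obtain ⟨K, hK, h⟩ := IsLorentzian.exists_forall_coeff_mul_le l (tutteVariable a)
    (tutteVariable b) (tutteVariable c) (tutteVariable e)
  rw [hlen] at h
  have hm : (∑ s ∈ S, Finsupp.single (tutteVariable s) 1 : Fin (n + 1) →₀ ℕ) =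
      (l.map fun i => Finsupp.single i 1).sum := by
    rw [hl, List.map_map]; exact (Finset.sum_map_toList S _).symm
  have hexp : ∀ x y, x ∉ S → y ∉ S → x ≠ y → Finsupp.single (tutteVariable x) 1 +
      (Finsupp.single (tutteVariable y) 1 + ∑ s ∈ S, Finsupp.single (tutteVariable s) 1) =
      tutteExponent (insert x (insert y S)).toLeft := by
    intro x y hx hy hxy
    have hx' : x ∉ insert y S := by simp [hx, hxy]
    rw [← sum_single_tutteVariable, Finset.sum_insert hx', Finset.sum_insert hy]
    rw [Finset.card_insert_of_notMem hx', Finset.card_insert_of_notMem hy]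
    omega
  refine le_max_of_forall_rpow_le (K := K) fun p hp hp1 => ?_
  have := h _ (hr p hp hp1) _ hm
  rw [hexp a b ha hb hab, hexp c e hc he hce, hexp a c ha hc hac, hexp b e hb he hbe,
    hexp a e ha he hae, hexp b c hb hc hbc] at this
  simp only [coeff_tuttePoly, ← Real.rpow_add hp, ← neg_add] at this
  exact this

/-! ### Matroid ranks and flag matroids -/

theorem matroidRk_cast {E : Type*} (M : Matroid E) (S : Finset E) :
    (matroidRk M S : ℕ∞) = M.eRk (S : Set E) := by
  refine ENat.natCast_toNat ?_
  exact ne_top_of_le_ne_top (by simp) (M.eRk_le_encard (S : Set E))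

theorem matroidRk_mono {E : Type*} (M : Matroid E) {S T : Finset E} (h : S ⊆ T) :
    matroidRk M S ≤ matroidRk M T := by
  have := M.eRk_mono (Finset.coe_subset.2 h)
  rw [← matroidRk_cast, ← matroidRk_cast] at this
  exact_mod_cast this

theorem matroidRk_union_add_inter_le {E : Type*} [DecidableEq E] (M : Matroid E) (S T : Finset E) :
    matroidRk M (S ∪ T) + matroidRk M (S ∩ T) ≤ matroidRk M S + matroidRk M T := by
  have := M.eRk_inter_add_eRk_union_le (S : Set E) T
  rw [← Finset.coe_inter, ← Finset.coe_union] at this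
  simp only [← matroidRk_cast] at this
  have : matroidRk M (S ∩ T) + matroidRk M (S ∪ T) ≤ matroidRk M S + matroidRk M T := by
    exact_mod_cast this
  omega

theorem matroidRk_insert_le {E : Type*} [DecidableEq E] (M : Matroid E) (a : E) (S : Finset E) :
    matroidRk M (insert a S) ≤ matroidRk M S + 1 := by
  have := M.eRk_insert_le_add_one a (S : Set E)
  rw [← Finset.coe_insert] at this
  simp only [← matroidRk_cast] at this
  exact_mod_cast this

/-- Local submodularity of the rank function. -/
theorem matroidRk_insert_insert_add_le {E : Type*} [DecidableEq E] (M : Matroid E) (S : Finset E)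
    (a b : E) :
    matroidRk M (insert a (insert b S)) + matroidRk M S ≤
      matroidRk M (insert a S) + matroidRk M (insert b S) := by
  have h1 := matroidRk_union_add_inter_le M (insert a S) (insert b S)
  have h2 : matroidRk M S ≤ matroidRk M (insert a S ∩ insert b S) :=
    matroidRk_mono M (Finset.subset_inter (Finset.subset_insert _ _) (Finset.subset_insert _ _))
  have h3 : insert a S ∪ insert b S = insert a (insert b S) := by
    ext x; simp; tauto
  rw [h3] at h1
  omega

theorem IsFlagMatroid.quotient_of_le {E : Type*} {ℓ : ℕ} {M : Fin ℓ → Matroid E}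
    (h : IsFlagMatroid M) {k k' : Fin ℓ} (hk : k ≤ k') : IsMatroidQuotient (M k) (M k') := by
  obtain ⟨k, hk0⟩ := k
  obtain ⟨k', hk1⟩ := k'
  rw [Fin.mk_le_mk] at hk
  induction k', hk using Nat.le_induction with
  | base => intro S T _; omega
  | succ m hm ih =>
    intro S T hST
    have h1 := ih (by omega) S T hST
    have h2 := h.quotient ⟨m, by omega⟩ ⟨m + 1, hk1⟩ rfl S T hST
    omega

/-- In a matroid and a quotient of it, the minimum among the three numbers `rk(ab) + rk(c)`,
`rk(ac) + rk(b)`, `rk(bc) + rk(a)` cannot be attained uniquely at different places. -/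
theorem IsMatroidQuotient.not_lt_and_lt {E : Type*} [DecidableEq E] {N M : Matroid E}
    (h : IsMatroidQuotient N M) (S : Finset E) (a b c : E)
    (hN : matroidRk N (insert a (insert c S)) + matroidRk N (insert b S) <
      matroidRk N (insert a (insert b S)) + matroidRk N (insert c S))
    (hM : matroidRk M (insert b (insert c S)) + matroidRk M (insert a S) <
      matroidRk M (insert a (insert b S)) + matroidRk M (insert c S)) : False := by
  -- Contract `S`. By `hN`, `a` and `c` are parallel non-loops in `N` but `a` and `b` are not; by
  -- `hM`, `b` and `c` are parallel in `M`. The quotient relation gives `rk_N(bc) = rk_N(b) =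
  -- rk_N(c) = 1`, so `b` is parallel to `c`, hence to `a`, in `N`, a contradiction. `omega` finds
  -- this from the rank inequalities.
  have sub1 : ∀ (x : E) (T : Finset E), T ⊆ insert x T := fun x T => Finset.subset_insert x T
  have hq : ∀ (x : E) (T : Finset E), matroidRk N (insert x T) + matroidRk M T ≤
    matroidRk M (insert x T) + matroidRk N T := fun x T => h _ _ (sub1 x T)
  have hm : ∀ (L : Matroid E) (x : E) (T : Finset E), matroidRk L T ≤ matroidRk L (insert x T) :=
    fun L x T => matroidRk_mono L (sub1 x T)
  have hu := @matroidRk_insert_le E _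
  have hs := @matroidRk_insert_insert_add_le E _
  have c1 := Finset.insert_comm b a S
  have c2 := Finset.insert_comm c a S
  have c4 := Finset.insert_comm c b S
  have c5 : insert b (insert a (insert c S)) = insert a (insert b (insert c S)) :=
    Finset.insert_comm _ _ _
  have c6 : insert c (insert a (insert b S)) = insert a (insert b (insert c S)) := by
    rw [Finset.insert_comm c a, Finset.insert_comm c b]
  have facts : ∀ L : Matroid E, _ := fun L => And.intro (hs L S a b) <| And.intro (hs L S a c) <|
    And.intro (hs L S b c) <| And.intro (hs L (insert a S) b c) <|
    And.intro (hs L (insert b S) a c) <| And.intro (hs L (insert c S) a b) <|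
    And.intro (hu L a S) <| And.intro (hu L b S) <| And.intro (hu L c S) <|
    And.intro (hm L a S) <| And.intro (hm L b S) <| And.intro (hm L c S) <|
    And.intro (hm L a (insert b S)) <| And.intro (hm L b (insert a S)) <|
    And.intro (hm L a (insert c S)) <| And.intro (hm L c (insert a S)) <|
    And.intro (hm L b (insert c S)) <| And.intro (hm L c (insert b S)) <|
    And.intro (hm L a (insert b (insert c S))) <| And.intro (hm L b (insert a (insert c S))) 
      (hm L c (insert a (insert b S)))
  have fN := facts N
  have fM := facts M
  have q1 := hq a S
  have q2 := hq b S
  have q3 := hq c S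
  have q4 := hq a (insert b S)
  have q5 := hq b (insert a S)
  have q6 := hq a (insert c S)
  have q7 := hq c (insert a S)
  have q8 := hq b (insert c S)
  have q9 := hq c (insert b S)
  have q10 := hq a (insert b (insert c S))
  have q11 := hq b (insert a (insert c S))
  have q12 := hq c (insert a (insert b S))
  rw [c1, c2, c4] at *
  rw [c5, c6] at *
  clear facts hq hm hu hs sub1
  omega

/-- Nonnegative combinations of the rank functions of a flag matroid are `M♮`-concave. -/
theorem IsFlagMatroid.isMNaturalConcave {E : Type*} [Fintype E] [DecidableEq E] {ℓ : ℕ}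
    {M : Fin ℓ → Matroid E} (hM : IsFlagMatroid M) {c : Fin ℓ → ℝ} (hc : ∀ k, 0 ≤ c k) :
    IsMNaturalConcave fun S : Finset E => ∑ k, c k * (matroidRk (M k) S : ℝ) := by
  have sum_le : ∀ A B C D : Finset E, (∀ k, matroidRk (M k) A + matroidRk (M k) B ≤
      matroidRk (M k) C + matroidRk (M k) D) →
      ∑ k, c k * (matroidRk (M k) A : ℝ) + ∑ k, c k * (matroidRk (M k) B : ℝ) ≤
        ∑ k, c k * (matroidRk (M k) C : ℝ) + ∑ k, c k * (matroidRk (M k) D : ℝ) := by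
    intro A B C D h
    rw [← Finset.sum_add_distrib, ← Finset.sum_add_distrib]
    refine Finset.sum_le_sum fun k _ => ?_
    rw [← mul_add, ← mul_add]
    exact mul_le_mul_of_nonneg_left (by exact_mod_cast h k) (hc k)
  refine isMNaturalConcave_of_local ?_ ?_
  · intro S a b _ _ _
    exact sum_le _ _ _ _ fun k => matroidRk_insert_insert_add_le (M k) S a b
  · intro S x y z _ _ _ _ _ _
    rw [le_max_iff]
    by_contra! hcon
    have h1 : ∃ k, matroidRk (M k) (insert x (insert z S)) + matroidRk (M k) (insert y S) <
        matroidRk (M k) (insert x (insert y S)) + matroidRk (M k) (insert z S) := by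
      by_contra! h
      exact absurd (sum_le _ _ _ _ h) (not_le.2 hcon.1)
    have h2 : ∃ k, matroidRk (M k) (insert y (insert z S)) + matroidRk (M k) (insert x S) <
        matroidRk (M k) (insert x (insert y S)) + matroidRk (M k) (insert z S) := by
      by_contra! h
      exact absurd (sum_le _ _ _ _ h) (not_le.2 hcon.2)
    obtain ⟨k, hk⟩ := h1
    obtain ⟨k', hk'⟩ := h2
    rcases le_total k k' with hle | hle
    · exact (hM.quotient_of_le hle).not_lt_and_lt S x y z hk hk'
    -- The roles of `x` and `y` are swapped, so that the violation in the quotient comes first.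
    · refine (hM.quotient_of_le hle).not_lt_and_lt S y x z ?_ ?_
      · rwa [Finset.insert_comm y x]
      · rwa [Finset.insert_comm y x]
theorem mainTheorem6 (n : ℕ) :
    (∀ r ∈ lorentzianSetFunctions n, IsMNaturalConcave r) ∧
    lorentzianSetFunctions n ⊆ (submodularCone n : Set (Finset (Fin n) → ℝ)) ∧
    (∀ (ℓ : ℕ) (M : Fin ℓ → Matroid (Fin n)) (c : Fin ℓ → ℝ), IsFlagMatroid M → (∀ k, 0 ≤ c k) →
      IsMNaturalConcave (fun S : Finset (Fin n) => ∑ k, c k * (matroidRk (M k) S : ℝ))) := by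
  have hM : ∀ r ∈ lorentzianSetFunctions n, IsMNaturalConcave r := fun r hr =>
    isMNaturalConcave_of_threeTermExchange (threeTermExchange_of_mem_lorentzianSetFunctions hr)
  exact ⟨hM, fun r hr => (hM r hr).submodular, fun ℓ M c hF hc => hF.isMNaturalConcave hc⟩
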